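/- Let $\mathcal X$ be a nonempty set and let $\mathcal C$ be a nonempty class of functions $\mathcal X\to[-1,1]$. For $T\in\mathbb N$, an $\mathcal X$-valued tree of depth $T$ is a sequence $\mathbf x=(\mathbf x_1,\dots,\mathbf x_T)$ of functions $\mathbf x_t:\{\pm1\}^{t-1}\to\mathcal X$, and the sequential Rademacher complexity of $\mathcal C$ is $$\mathsf{srad}_T(\mathcal C)=\sup_{\mathbf x}\ \mathbb E_{\sigma}\Big[\sup_{c\in\mathcal C}\frac1T\sum_{t=1}^T\sigma_t\,c\big(\mathbf x_t(\sigma_1,\dots,\sigma_{t-1})\big)\Big],\qquad \sigma\text{ uniform on }\{\pm1\}^T$$ (this is always finite, because $\mathcal C$ is $[-1,1]$-valued; $T\cdot\mathsf{srad}_T(\mathcal C)=0$ for $T=0$). A learner and an adaptive adversary interact over $T$ rounds. In round $t$ the learner chooses a distribution $Q_t$ over functions $\mathcal X\to[-1,1]$ and, simultaneously, the adversary chooses $(x_t,y_t)\in\mathcal X\times[-1,1]$; both may depend on the past $(q_s,x_s,y_s)_{s<t}$ only. Then $q_t\sim Q_t$ is sampled with fresh randomness. For $\delta\in(0,1)$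 and $R\in\mathbb R$, the learner is an online weak agnostic learner for $\mathcal C$ with failure probability $\delta$ and regret bound $R$ if against every adversary, with probability at least $1-\delta$ over the learner's internal randomness, $$\sup_{c\in\mathcal C}\sum_{t=1}^T c(x_t)\,y_t\ \le\ \sum_{t=1}^T\mathbb E_{q\sim Q_t}\big[q(x_t)\,y_t\big]+R .$$ There are absolute constants $a,A>0$ such that for all $\mathcal X$, $\mathcal C$ and $T$ as above: 1. there is a learner that, for every $\delta\in(0,1)$, is an online weak agnostic learner for $\mathcal C$ over $T$ rounds with failure probability $\delta$ and regret bound $A\cdot T\cdot\mathsf{srad}_T(\mathcal C)$; 2. no learner can do better up to the constant: if, for some $\delta\in(0,1)$ and $R\in\mathbb R$, some learner is an online weak agnostic learner for $\mathcal C$ over $T$ rounds with failure probability $\delta$ and regret bound $R$, then $R\ge a\cdot T\cdot\mathsf{srad}_T(\mathcal C)$. -/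

import Mathlib

open MeasureTheory

universe u w

noncomputable section

namespace OnlineWeakAgnostic

/-- The interval `[-1, 1]`, the range of predictors and of labels. -/
abbrev Label : Type := Set.Icc (-1 : ℝ) 1

/-- Predictors (and hypotheses) `X → [-1, 1]`, with the product σ-algebra. -/
abbrev Predictor (X : Type u) : Type u := X → Label

/-! ### Sequential Rademacher complexity -/

/-- An `X`-valued complete binary tree of depth `m`: the label of the node in level `i`
(counted from `0`) is a function of the first `i` signs of the path leading to it. -/
abbrev BinTree (X : Type u) (m : ℕ) : Type u := (i : Fin m) → (Fin i → ℤˣ) → X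

/-- The label `𝐱ᵢ(σ)` met in level `i` on the path `σ ∈ {±1}ᵐ`. -/
def BinTree.label {X : Type u} {m : ℕ} (x : BinTree X m) (σ : Fin m → ℤˣ) (i : Fin m) : X :=
  x i (fun j => σ (Fin.castLE i.is_lt.le j))

/-- `𝔼_σ sup_{f ∈ F} (1/m) ∑ᵢ σᵢ f(𝐱ᵢ(σ))`, for `σ` uniform on `{±1}ᵐ`. -/
def treeSrad {X : Type u} (F : Set (Predictor X)) {m : ℕ} (x : BinTree X m) : ℝ :=
  (∑ σ : Fin m → ℤˣ,
    ⨆ f : F, (1 / (m : ℝ)) * ∑ i : Fin m, ((σ i : ℤ) : ℝ) * (f.1 (x.label σ i) : ℝ)) / 2 ^ m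

/-- Sequential Rademacher complexity: the supremum of `treeSrad` over all trees of depth `m`. -/
def srad {X : Type u} (m : ℕ) (F : Set (Predictor X)) : ℝ :=
  ⨆ x : BinTree X m, treeSrad F x

/-- The inner quantity is at most `1`, so that the supremum over `F` is a genuine one. -/
theorem signed_avg_le_one {X : Type u} (f : Predictor X) {m : ℕ} (x : BinTree X m)
    (σ : Fin m → ℤˣ) :
    (1 / (m : ℝ)) * ∑ i : Fin m, ((σ i : ℤ) : ℝ) * (f (x.label σ i) : ℝ) ≤ 1 := by
  have h : ∑ i : Fin m, ((σ i : ℤ) : ℝ) * (f (x.label σ i) : ℝ) ≤ m := by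
    calc _ ≤ ∑ _i : Fin m, (1 : ℝ) := by
          refine Finset.sum_le_sum fun i _ => ?_
          have h1 := (f (x.label σ i)).2.1
          have h2 := (f (x.label σ i)).2.2
          rcases Int.units_eq_one_or (σ i) with h | h <;> simp [h] <;> linarith
      _ = m := by simp
  rw [one_div, ← div_eq_inv_mul]
  exact div_le_one_of_le₀ h (Nat.cast_nonneg m)

/-- The sequential Rademacher complexity of a class of `[-1, 1]`-valued functions is always
finite: the values `treeSrad F x` are bounded above. -/
theorem bddAbove_treeSrad {X : Type u} (F : Set (Predictor X)) (m : ℕ) :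
    BddAbove (Set.range fun x : BinTree X m => treeSrad F x) := by
  refine ⟨1, ?_⟩
  rintro _ ⟨x, rfl⟩
  have h : ∑ σ : Fin m → ℤˣ,
      ⨆ f : F, (1 / (m : ℝ)) * ∑ i : Fin m, ((σ i : ℤ) : ℝ) * (f.1 (x.label σ i) : ℝ)
      ≤ ∑ _σ : Fin m → ℤˣ, (1 : ℝ) :=
    Finset.sum_le_sum fun σ _ =>
      Real.iSup_le (fun f => signed_avg_le_one f.1 x σ) zero_le_one
  refine div_le_one_of_le₀ (h.trans ?_) (by positivity)
  simp

/-! ### The simultaneous-move protocol -/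

/-- What is recorded of a round: the sampled predictor, the context and the label. -/
structure Round (X : Type u) : Type u where
  predictor : Predictor X
  context : X
  label : Label

/-- A randomized learner for `T` rounds. It tosses a fresh coin `ω ∼ μ` in each round, and its
prediction in round `t` is the predictor `sample t h ω`, where `h` is the record of the rounds
before round `t`. -/
structure Learner (X : Type u) (T : ℕ) : Type (max u (w + 1)) where
  Ω : Type w
  [measurableSpace : MeasurableSpace Ω]
  μ : Measure Ω
  [isProbabilityMeasure : IsProbabilityMeasure μ]
  sample : (t : Fin T) → (Fin t → Round X) → Ω → Predictor X
  measurable_sample : ∀ t h, Measurable (sample t h)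

attribute [instance] Learner.measurableSpace Learner.isProbabilityMeasure

/-- The randomized strategy `Q_t ∈ Δ(X → [-1, 1])` that the learner computes from the past `h`. -/
def Learner.strategy {X : Type u} {T : ℕ} (L : Learner.{u, w} X T) (t : Fin T)
    (h : Fin t → Round X) : ProbabilityMeasure (Predictor X) :=
  ⟨L.μ.map (L.sample t h),
    Measure.isProbabilityMeasure_map (L.measurable_sample t h).aemeasurable⟩

/-- The joint law of the learner's coins: independent over the rounds. -/
def Learner.coinLaw {X : Type u} {T : ℕ} (L : Learner.{u, w} X T) : Measure (Fin T → L.Ω) :=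
  Measure.pi fun _ => L.μ

/-- An adaptive adversary: in round `t` it chooses a context and a label from the record of the
earlier rounds, without access to the predictor sampled in round `t`. -/
abbrev Adversary (X : Type u) (T : ℕ) : Type u :=
  (t : Fin T) → (Fin t → Round X) → X × Label

/-- The record of the first `t` rounds of the interaction, when the learner's coins are `ω`. -/
def record {X : Type u} {T : ℕ} (L : Learner.{u, w} X T) (A : Adversary X T)
    (ω : Fin T → L.Ω) : (t : ℕ) → t ≤ T → Fin t → Round X
  | 0, _ => Fin.elim0
  | t + 1, ht =>
    let h : Fin t → Round X := record L A ω t (Nat.le_of_succ_le ht)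
    let move := A ⟨t, ht⟩ h
    Fin.snoc (α := fun _ => Round X) h ⟨L.sample ⟨t, ht⟩ h (ω ⟨t, ht⟩), move.1, move.2⟩

/-- The record of the rounds strictly before round `t`. -/
def past {X : Type u} {T : ℕ} (L : Learner.{u, w} X T) (A : Adversary X T)
    (ω : Fin T → L.Ω) (t : Fin T) : Fin t → Round X :=
  record L A ω t t.is_lt.le

/-- `L` is an online weak agnostic learner for `C` over `T` rounds, with failure probability `δ`
and regret bound `R`: against every adaptive adversary, the guarantee
`sup_{c ∈ C} ∑ₜ c(xₜ) yₜ ≤ ∑ₜ 𝔼_{q ∼ Qₜ}[q(xₜ) yₜ] + R`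
holds with probability at least `1 - δ` over the learner's internal randomness, that is, the set
of coins for which it fails has (outer) probability at most `δ`. -/
def IsOnlineWeakAgnosticLearner {X : Type u} {T : ℕ} (L : Learner.{u, w} X T)
    (C : Set (Predictor X)) (δ R : ℝ) : Prop :=
  ∀ A : Adversary X T,
    L.coinLaw {ω : Fin T → L.Ω | ¬ ∀ c ∈ C,
      ∑ t : Fin T,
          (c (A t (past L A ω t)).1 : ℝ) * ((A t (past L A ω t)).2 : ℝ) ≤
        ∑ t : Fin T,
          (∫ q : Predictor X,
            (q (A t (past L A ω t)).1 : ℝ) * ((A t (past L A ω t)).2 : ℝ)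
              ∂(L.strategy t (past L A ω t) : Measure (Predictor X))) + R}
      ≤ ENNReal.ofReal δ

end OnlineWeakAgnostic

end

noncomputable section

namespace OnlineWeakAgnostic

/-! ### Sign vectors and trees -/

/-! Both constants are 1, and both bounds hold for every outcome of the coins. Upper bound: let
`potential k g` measure the cumulative payoffs `g` of the class with `k` rounds to go. It equals `T
* srad T C` at the start and `sup_c g c` at the end. Grafting two trees under a root `x` shows that
the average of the potentials at `g ± c(x)` is at most the potential one level up; convexity in `g`
reduces a label in [-1, 1] to the two extreme labels. Predicting half the difference of these
potentials therefore pays for any growth of the potential (`potential_step`), and telescoping bounds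
the regret (`payoff_regret`). This learner is deterministic. Lower bound: against uniform signs on a
tree the learner's mean payoff is zero, while the comparator earns the tree's Rademacher sum. Since
the learner's mean prediction is a function of the past, an adaptive adversary can derandomize the
signs by conditional expectations (`mean_add_le_of_bestSign`). The regret is then large for all
coins, so a failure probability below 1 does not help. -/

theorem sum_units (f : ℤˣ → ℝ) : ∑ s : ℤˣ, f s = f 1 + f (-1) := by
  have h : (Finset.univ : Finset ℤˣ) = {1, -1} := rfl
  rw [h, Finset.sum_pair (by decide)]

theorem sum_signs_succ {k : ℕ} (F : (Fin (k + 1) → ℤˣ) → ℝ) :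
    ∑ σ, F σ = ∑ τ : Fin k → ℤˣ, F (Fin.cons 1 τ) + ∑ τ : Fin k → ℤˣ, F (Fin.cons (-1) τ) := by
  rw [← (Fin.consEquiv fun _ : Fin (k + 1) => ℤˣ).sum_comp, Fintype.sum_prod_type, sum_units]
  rfl

/-- The tree with root `x₀` whose subtrees are `tr 1` and `tr (-1)`. -/
def BinTree.cons {X : Type u} {k : ℕ} (x₀ : X) (tr : ℤˣ → BinTree X k) : BinTree X (k + 1) :=
  fun i => Fin.cases (motive := fun i : Fin (k + 1) => (Fin i → ℤˣ) → X) (fun _ => x₀)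
    (fun i s => tr (s (0 : Fin (i.1 + 1))) i fun j => s (Fin.succ (n := i.1) j)) i

theorem BinTree.label_cons_zero {X : Type u} {k : ℕ} (x₀ : X) (tr : ℤˣ → BinTree X k)
    (σ : Fin (k + 1) → ℤˣ) : (BinTree.cons x₀ tr).label σ 0 = x₀ := rfl

theorem BinTree.label_cons_succ {X : Type u} {k : ℕ} (x₀ : X) (tr : ℤˣ → BinTree X k)
    (s : ℤˣ) (τ : Fin k → ℤˣ) (i : Fin k) :
    (BinTree.cons x₀ tr).label (Fin.cons s τ) i.succ = (tr s).label τ i := rfl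

/-- The signed sum of `f` along the path `σ` of the tree `x`. -/
def signedSum {X : Type u} (f : Predictor X) {m : ℕ} (x : BinTree X m) (σ : Fin m → ℤˣ) : ℝ :=
  ∑ i : Fin m, ((σ i : ℤ) : ℝ) * (f (x.label σ i) : ℝ)

theorem signedSum_le {X : Type u} (f : Predictor X) {m : ℕ} (x : BinTree X m)
    (σ : Fin m → ℤˣ) : signedSum f x σ ≤ m := by
  calc _ ≤ ∑ _i : Fin m, (1 : ℝ) := by
        refine Finset.sum_le_sum fun i _ => ?_
        have h1 := (f (x.label σ i)).2.1
        have h2 := (f (x.label σ i)).2.2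
        rcases Int.units_eq_one_or (σ i) with h | h <;> simp [h] <;> linarith
    _ = m := by simp

theorem signedSum_cons {X : Type u} (f : Predictor X) {k : ℕ} (x₀ : X)
    (tr : ℤˣ → BinTree X k) (s : ℤˣ) (τ : Fin k → ℤˣ) :
    signedSum f (BinTree.cons x₀ tr) (Fin.cons s τ) =
      ((s : ℤ) : ℝ) * (f x₀ : ℝ) + signedSum f (tr s) τ := by
  simp only [signedSum, Fin.sum_univ_succ, BinTree.label_cons_zero, BinTree.label_cons_succ,
    Fin.cons_zero, Fin.cons_succ]

/-! ### The potential of a vector of cumulative payoffs -/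

/-- The value at `x` of the members of `C`. -/
def evalAt {X : Type u} (C : Set (Predictor X)) (x : X) : C → ℝ := fun c => (c.1 x : ℝ)

/-- `𝔼_σ sup_c (g c + ∑ᵢ σᵢ c(𝐱ᵢ(σ)))` for a fixed tree `𝐱`. -/
def treeValue {X : Type u} {C : Set (Predictor X)} (g : C → ℝ) {k : ℕ} (x : BinTree X k) : ℝ :=
  (∑ σ : Fin k → ℤˣ, ⨆ c : C, (g c + signedSum c.1 x σ)) / 2 ^ k

/-- `sup_𝐱 𝔼_σ sup_c (g c + ∑ᵢ σᵢ c(𝐱ᵢ(σ)))`, over the trees `𝐱` of depth `k`. -/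
def potential {X : Type u} {C : Set (Predictor X)} (k : ℕ) (g : C → ℝ) : ℝ :=
  ⨆ x : BinTree X k, treeValue g x

section Potential

variable {X : Type u} {C : Set (Predictor X)} {k : ℕ}

theorem bddAbove_add_signedSum {g : C → ℝ} (hg : BddAbove (Set.range g)) (x : BinTree X k)
    (σ : Fin k → ℤˣ) : BddAbove (Set.range fun c : C => g c + signedSum c.1 x σ) := by
  obtain ⟨B, hB⟩ := hg
  refine ⟨B + k, ?_⟩
  rintro _ ⟨c, rfl⟩
  exact add_le_add (hB ⟨c, rfl⟩) (signedSum_le c.1 x σ)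

theorem treeValue_le_of_forall {g : C → ℝ} {x : BinTree X k} {b : ℝ}
    (h : ∀ σ, ⨆ c : C, (g c + signedSum c.1 x σ) ≤ b) : treeValue g x ≤ b := by
  rw [treeValue, div_le_iff₀ (by positivity)]
  refine (Finset.sum_le_sum fun σ _ => h σ).trans ?_
  simp [mul_comm]

theorem treeValue_cons (g : C → ℝ) (x₀ : X) (tr : ℤˣ → BinTree X k) :
    treeValue g (BinTree.cons x₀ tr) =
      (treeValue (g + evalAt C x₀) (tr 1) + treeValue (g - evalAt C x₀) (tr (-1))) / 2 := by
  have h (s : ℤˣ) (τ : Fin k → ℤˣ) (c : C) :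
      g c + signedSum c.1 (BinTree.cons x₀ tr) (Fin.cons s τ) =
        (g c + ((s : ℤ) : ℝ) * evalAt C x₀ c) + signedSum c.1 (tr s) τ := by
    rw [signedSum_cons, evalAt]
    ring
  simp only [treeValue, sum_signs_succ, h, Pi.add_apply, Pi.sub_apply]
  simp only [Units.val_one, Int.cast_one, one_mul, Units.val_neg, Int.cast_neg,
    neg_mul, ← sub_eq_add_neg, pow_succ]
  field_simp

theorem bddAbove_add_evalAt {g : C → ℝ} (hg : BddAbove (Set.range g)) (x : X) :
    BddAbove (Set.range (g + evalAt C x)) := by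
  obtain ⟨B, hB⟩ := hg
  refine ⟨B + 1, ?_⟩
  rintro _ ⟨c, rfl⟩
  exact add_le_add (hB ⟨c, rfl⟩) (c.1 x).2.2

theorem bddAbove_sub_evalAt {g : C → ℝ} (hg : BddAbove (Set.range g)) (x : X) :
    BddAbove (Set.range (g - evalAt C x)) := by
  obtain ⟨B, hB⟩ := hg
  refine ⟨B + 1, ?_⟩
  rintro _ ⟨c, rfl⟩
  have h1 := hB ⟨c, rfl⟩
  have h2 := (c.1 x).2.1
  simp only [Pi.sub_apply, evalAt]
  linarith

theorem potential_zero (g : C → ℝ) : potential 0 g = ⨆ c : C, g c := by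
  simp [potential, treeValue, signedSum]

theorem potential_eq_mul_srad (T : ℕ) :
    potential T (0 : C → ℝ) = T * srad T C := by
  rw [potential, srad, Real.mul_iSup_of_nonneg (Nat.cast_nonneg T)]
  congr 1
  ext x
  rw [treeValue, treeSrad, ← mul_div_assoc, Finset.mul_sum]
  congr 1
  refine Finset.sum_congr rfl fun σ _ => ?_
  rw [Real.mul_iSup_of_nonneg (Nat.cast_nonneg T)]
  congr 1
  ext c
  -- For `T = 0` the factor `1 / T` is 0, but the signed sum is empty as well.
  rcases Nat.eq_zero_or_pos T with rfl | hT
  · simp [signedSum]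
  · have : (T : ℝ) ≠ 0 := by positivity
    rw [← mul_assoc, mul_one_div_cancel this, one_mul, Pi.zero_apply, zero_add, signedSum]

variable [Nonempty C]

theorem bddAbove_treeValue {g : C → ℝ} (hg : BddAbove (Set.range g)) :
    BddAbove (Set.range fun x : BinTree X k => treeValue g x) := by
  obtain ⟨B, hB⟩ := hg
  refine ⟨B + k, ?_⟩
  rintro _ ⟨x, rfl⟩
  exact treeValue_le_of_forall fun σ => ciSup_le fun c =>
    add_le_add (hB ⟨c, rfl⟩) (signedSum_le c.1 x σ)

theorem treeValue_le_potential {g : C → ℝ} (hg : BddAbove (Set.range g)) (x : BinTree X k) :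
    treeValue g x ≤ potential k g :=
  le_ciSup (bddAbove_treeValue hg) x

/-- An average of suprema of functions affine in `g` is convex. -/
theorem treeValue_convex {g₁ g₂ : C → ℝ} (h₁ : BddAbove (Set.range g₁))
    (h₂ : BddAbove (Set.range g₂)) {p q : ℝ} (hp : 0 ≤ p) (hq : 0 ≤ q) (hpq : p + q = 1)
    (x : BinTree X k) :
    treeValue (fun c => p * g₁ c + q * g₂ c) x ≤ p * treeValue g₁ x + q * treeValue g₂ x := by
  rw [treeValue, treeValue, treeValue, ← mul_div_assoc, ← mul_div_assoc, ← add_div,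
    Finset.mul_sum, Finset.mul_sum, ← Finset.sum_add_distrib]
  refine div_le_div_of_nonneg_right (Finset.sum_le_sum fun σ _ => ciSup_le fun c => ?_)
    (by positivity)
  calc p * g₁ c + q * g₂ c + signedSum c.1 x σ
      = p * (g₁ c + signedSum c.1 x σ) + q * (g₂ c + signedSum c.1 x σ) := by
        linear_combination (-signedSum c.1 x σ) * hpq
    _ ≤ _ := add_le_add
        (mul_le_mul_of_nonneg_left (le_ciSup (bddAbove_add_signedSum h₁ x σ) c) hp)
        (mul_le_mul_of_nonneg_left (le_ciSup (bddAbove_add_signedSum h₂ x σ) c) hq)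

theorem treeValue_le_add {g₁ g₂ : C → ℝ} (h₂ : BddAbove (Set.range g₂)) {b : ℝ}
    (h : ∀ c, g₁ c ≤ g₂ c + b) (x : BinTree X k) : treeValue g₁ x ≤ treeValue g₂ x + b := by
  have hb : treeValue g₂ x + b =
      (∑ σ : Fin k → ℤˣ, ((⨆ c : C, (g₂ c + signedSum c.1 x σ)) + b)) / 2 ^ k := by
    rw [Finset.sum_add_distrib, add_div, treeValue]
    simp
  rw [hb, treeValue]
  refine div_le_div_of_nonneg_right (Finset.sum_le_sum fun σ _ => ciSup_le fun c => ?_)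
    (by positivity)
  linarith [h c, le_ciSup (bddAbove_add_signedSum h₂ x σ) c]

variable [Nonempty X]

theorem potential_convex {g₁ g₂ : C → ℝ} (h₁ : BddAbove (Set.range g₁))
    (h₂ : BddAbove (Set.range g₂)) {p q : ℝ} (hp : 0 ≤ p) (hq : 0 ≤ q) (hpq : p + q = 1) :
    potential k (fun c => p * g₁ c + q * g₂ c) ≤ p * potential k g₁ + q * potential k g₂ :=
  ciSup_le fun x => (treeValue_convex h₁ h₂ hp hq hpq x).trans <| add_le_add
    (mul_le_mul_of_nonneg_left (treeValue_le_potential h₁ x) hp)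
    (mul_le_mul_of_nonneg_left (treeValue_le_potential h₂ x) hq)

theorem potential_le_add {g₁ g₂ : C → ℝ} (h₂ : BddAbove (Set.range g₂)) {b : ℝ}
    (h : ∀ c, g₁ c ≤ g₂ c + b) : potential k g₁ ≤ potential k g₂ + b :=
  ciSup_le fun x => (treeValue_le_add h₂ h x).trans
    (add_le_add_left (treeValue_le_potential h₂ x) b)

/-- Trees chosen separately for the two signs of the root form one tree of depth `k + 1`, so the two
suprema can be taken independently. -/
theorem potential_add_potential_le {g : C → ℝ} (hg : BddAbove (Set.range g)) (x₀ : X) :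
    (potential k (g + evalAt C x₀) + potential k (g - evalAt C x₀)) / 2 ≤
      potential (k + 1) g := by
  have h (x₁ x₂ : BinTree X k) :
      treeValue (g + evalAt C x₀) x₁ + treeValue (g - evalAt C x₀) x₂ ≤
        2 * potential (k + 1) g := by
    have := treeValue_le_potential hg (BinTree.cons x₀ fun s => if s = 1 then x₁ else x₂)
    rw [treeValue_cons] at this
    have h1 : (-1 : ℤˣ) ≠ 1 := by decide
    simp only [if_true, h1, if_false] at this
    linarith
  have h1 : potential k (g + evalAt C x₀) ≤
      2 * potential (k + 1) g - potential k (g - evalAt C x₀) :=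
    ciSup_le fun x₁ => le_sub_comm.1 <| ciSup_le fun x₂ => by linarith [h x₁ x₂]
  linarith

/-! ### The learner -/

/-- Half of the discrete derivative of the potential in the direction of the context `x`. -/
def prediction (C : Set (Predictor X)) (k : ℕ) (g : C → ℝ) (x : X) : ℝ :=
  (potential k (g + evalAt C x) - potential k (g - evalAt C x)) / 2

/-- As `|c x| ≤ 1`, the two payoff vectors differ by at most 2 in each coordinate, hence so do their
potentials. -/
theorem prediction_mem_Icc {g : C → ℝ} (hg : BddAbove (Set.range g)) (x : X) :
    prediction C k g x ∈ Set.Icc (-1 : ℝ) 1 := by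
  have h1 := potential_le_add (k := k) (g₁ := g + evalAt C x) (b := 2)
    (bddAbove_sub_evalAt hg x) fun c => by
      have := (c.1 x).2.2
      simp only [Pi.add_apply, Pi.sub_apply, evalAt]
      linarith
  have h2 := potential_le_add (k := k) (g₁ := g - evalAt C x) (b := 2)
    (bddAbove_add_evalAt hg x) fun c => by
      have := (c.1 x).2.1
      simp only [Pi.add_apply, Pi.sub_apply, evalAt]
      linarith
  constructor <;> rw [prediction] <;> linarith

/-- The new payoff vector is the mixture of `g ± evalAt C x` with weights `(1 ± y) / 2`. The same
mixture of the potentials is their average plus `y` times `prediction`. -/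
theorem potential_step {g : C → ℝ} (hg : BddAbove (Set.range g)) (x : X) (y : Label) :
    potential k (fun c => g c + (c.1 x : ℝ) * (y : ℝ)) ≤
      potential (k + 1) g + prediction C k g x * (y : ℝ) := by
  have hy1 := y.2.1
  have hy2 := y.2.2
  have h := potential_convex (k := k) (bddAbove_add_evalAt hg x) (bddAbove_sub_evalAt hg x)
    (p := (1 + y) / 2) (q := (1 - y) / 2) (by linarith) (by linarith) (by ring)
  have he : (fun c => (1 + (y : ℝ)) / 2 * (g + evalAt C x) c +
      (1 - (y : ℝ)) / 2 * (g - evalAt C x) c) = fun c => g c + (c.1 x : ℝ) * (y : ℝ) := by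
    ext c
    simp only [Pi.add_apply, Pi.sub_apply, evalAt]
    ring
  rw [he] at h
  have h' := potential_add_potential_le (k := k) hg x
  rw [prediction]
  linarith

end Potential

/-! ### Telescoping the potential along a play -/

/-- The cumulative payoffs of the members of `C` on a sequence of labelled contexts. -/
def payoff {X : Type u} (C : Set (Predictor X)) {t : ℕ} (m : Fin t → X × Label) : C → ℝ :=
  fun c => ∑ j, (c.1 (m j).1 : ℝ) * ((m j).2 : ℝ)

theorem mul_label_le_one (a b : Label) : (a : ℝ) * (b : ℝ) ≤ 1 := by
  have h : |(a : ℝ) * (b : ℝ)| ≤ 1 := by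
    rw [abs_mul]
    exact mul_le_one₀ (abs_le.2 a.2) (abs_nonneg _) (abs_le.2 b.2)
  exact (abs_le.1 h).2

theorem bddAbove_payoff {X : Type u} (C : Set (Predictor X)) {t : ℕ} (m : Fin t → X × Label) :
    BddAbove (Set.range (payoff C m)) := by
  refine ⟨∑ _j : Fin t, 1, ?_⟩
  rintro _ ⟨c, rfl⟩
  exact Finset.sum_le_sum fun j _ => mul_label_le_one _ _

theorem payoff_regret {X : Type u} [Nonempty X] (C : Set (Predictor X)) [Nonempty C] {T : ℕ}
    (m : Fin T → X × Label) (t : ℕ) (ht : t ≤ T) :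
    potential (T - t) (payoff C fun j : Fin t => m (Fin.castLE ht j)) ≤
      potential T (0 : C → ℝ) + ∑ j : Fin t,
        prediction C (T - (j + 1)) (payoff C fun i : Fin j => m (Fin.castLE (j.2.le.trans ht) i))
          (m (Fin.castLE ht j)).1 * ((m (Fin.castLE ht j)).2 : ℝ) := by
  induction t with
  | zero =>
    have : (payoff C fun j : Fin 0 => m (Fin.castLE ht j)) = 0 := by
      ext c
      simp [payoff]
    simp [this]
  | succ t ih =>
    have h := ih (Nat.le_of_succ_le ht)
    have hs := potential_step (k := T - (t + 1))
      (bddAbove_payoff C fun j : Fin t => m (Fin.castLE (Nat.le_of_succ_le ht) j))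
      (m ⟨t, ht⟩).1 (m ⟨t, ht⟩).2
    have hk : T - (t + 1) + 1 = T - t := by omega
    have he : (payoff C fun j : Fin (t + 1) => m (Fin.castLE ht j)) =
        fun c => payoff C (fun j : Fin t => m (Fin.castLE (Nat.le_of_succ_le ht) j)) c +
          (c.1 (m ⟨t, ht⟩).1 : ℝ) * ((m ⟨t, ht⟩).2 : ℝ) := by
      ext c
      simp only [payoff, Fin.sum_univ_castSucc]
      rfl
    rw [hk] at hs
    rw [he, Fin.sum_univ_castSucc, ← add_assoc]
    exact hs.trans (add_le_add_left h _)

/-! ### The potential-based learner in the protocol -/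

/-- The contexts and labels in a record. -/
def Round.move {X : Type u} (r : Round X) : X × Label := (r.context, r.label)

/-- Identifies the payoffs that the learner reads off its record with those of the adversary's
actual moves. -/
theorem move_record {X : Type u} {T : ℕ} (L : Learner.{u, w} X T) (A : Adversary X T)
    (ω : Fin T → L.Ω) (t : ℕ) (ht : t ≤ T) (j : Fin t) :
    (record L A ω t ht j).move = A (Fin.castLE ht j) (past L A ω (Fin.castLE ht j)) := by
  induction t with
  | zero => exact j.elim0
  | succ t ih =>
    rw [record]
    refine Fin.lastCases ?_ (fun j => ?_) j
    · simp only [Fin.snoc_last]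
      rfl
    · simp only [Fin.snoc_castSucc]
      exact ih _ j

theorem move_past {X : Type u} {T : ℕ} (L : Learner.{u, w} X T) (A : Adversary X T)
    (ω : Fin T → L.Ω) (t : Fin T) (j : Fin t) :
    (past L A ω t j).move =
      A (Fin.castLE t.2.le j) (past L A ω (Fin.castLE t.2.le j)) :=
  move_record L A ω t t.2.le j

/-- The predictor played in round `t` by the potential-based learner. -/
def potentialPredictor {X : Type u} (C : Set (Predictor X)) {T : ℕ} (t : Fin T)
    (h : Fin t → Round X) : Predictor X :=
  -- The projection only supplies the range; by `prediction_mem_Icc` it changes nothing for nonempty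
  -- `X` and `C`.
  fun x => Set.projIcc (-1) 1 (by norm_num)
    (prediction C (T - (t + 1)) (payoff C fun j => (h j).move) x)

/-- The deterministic learner that plays `potentialPredictor`. -/
def potentialLearner {X : Type u} (C : Set (Predictor X)) (T : ℕ) : Learner.{u, w} X T where
  Ω := PUnit.{w + 1}
  μ := Measure.dirac PUnit.unit
  sample t h _ := potentialPredictor C t h
  measurable_sample _ _ := measurable_const

theorem measurable_eval_mul {X : Type u} (x : X) (y : Label) :
    Measurable fun q : Predictor X => (q x : ℝ) * (y : ℝ) :=
  (measurable_subtype_coe.comp (measurable_pi_apply x)).mul_const _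

theorem integral_potentialLearner {X : Type u} (C : Set (Predictor X)) {T : ℕ} (t : Fin T)
    (h : Fin t → Round X) (x : X) (y : Label) :
    ∫ q : Predictor X, (q x : ℝ) * (y : ℝ)
        ∂((potentialLearner.{u, w} C T).strategy t h : Measure (Predictor X)) =
      (potentialPredictor C t h x : ℝ) * (y : ℝ) := by
  have : ((potentialLearner.{u, w} C T).strategy t h : Measure (Predictor X)) =
      Measure.dirac (potentialPredictor C t h) := by
    change Measure.map (fun _ => potentialPredictor C t h) (Measure.dirac PUnit.unit) = _
    rw [Measure.map_dirac' measurable_const]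
  rw [this, integral_dirac' _ _ (measurable_eval_mul x y).stronglyMeasurable]

theorem potentialPredictor_past {X : Type u} [Nonempty X] (C : Set (Predictor X)) [Nonempty C]
    {T : ℕ} (A : Adversary X T) (L : Learner.{u, w} X T) (ω : Fin T → L.Ω) (t : Fin T) (x : X) :
    (potentialPredictor C t (past L A ω t) x : ℝ) =
      prediction C (T - (t + 1)) (payoff C fun j : Fin t => A (Fin.castLE t.2.le j)
        (past L A ω (Fin.castLE t.2.le j))) x := by
  simp only [potentialPredictor, move_past]
  rw [Set.projIcc_of_mem _ (prediction_mem_Icc (bddAbove_payoff C _) _)]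

theorem regret_potentialLearner_le {X : Type u} [Nonempty X] {C : Set (Predictor X)} {T : ℕ}
    (A : Adversary X T) (ω : Fin T → (potentialLearner.{u, w} C T).Ω) {c : Predictor X}
    (hc : c ∈ C) :
    ∑ t : Fin T,
        (c (A t (past (potentialLearner.{u, w} C T) A ω t)).1 : ℝ) *
          ((A t (past (potentialLearner.{u, w} C T) A ω t)).2 : ℝ) ≤
      ∑ t : Fin T,
        (∫ q : Predictor X,
          (q (A t (past (potentialLearner.{u, w} C T) A ω t)).1 : ℝ) *
            ((A t (past (potentialLearner.{u, w} C T) A ω t)).2 : ℝ)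
            ∂((potentialLearner.{u, w} C T).strategy t
              (past (potentialLearner.{u, w} C T) A ω t) : Measure (Predictor X))) +
        T * srad T C := by
  have : Nonempty C := ⟨⟨c, hc⟩⟩
  have h := payoff_regret C (fun t => A t (past (potentialLearner.{u, w} C T) A ω t)) T le_rfl
  rw [Nat.sub_self, potential_zero, potential_eq_mul_srad, add_comm] at h
  simp only [integral_potentialLearner, potentialPredictor_past]
  exact (le_ciSup (bddAbove_payoff C _) ⟨c, hc⟩).trans h

theorem isOnlineWeakAgnosticLearner_potentialLearner {X : Type u} [Nonempty X]
    (C : Set (Predictor X)) (T : ℕ) (δ : ℝ) :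
    IsOnlineWeakAgnosticLearner (potentialLearner.{u, w} C T) C δ (T * srad T C) := by
  intro A
  refine le_of_eq_of_le ((congrArg _ ?_).trans measure_empty) zero_le
  exact Set.eq_empty_of_forall_notMem fun ω hω =>
    hω fun c hc => regret_potentialLearner_le A ω hc

/-! ### The adversary -/

/-- The conditional expectation of `G` given that the first `t` signs are those of `s`. -/
def prefixMean {T : ℕ} (G : (Fin T → ℤˣ) → ℝ) (t : ℕ) (s : Fin T → ℤˣ) : ℝ :=
  2 ^ t * (∑ σ : Fin T → ℤˣ, if ∀ j : Fin T, j.1 < t → σ j = s j then G σ else 0) / 2 ^ T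

section PrefixMean

variable {T : ℕ} (G : (Fin T → ℤˣ) → ℝ)

theorem prefixMean_congr {t : ℕ} {s s' : Fin T → ℤˣ} (h : ∀ j : Fin T, j.1 < t → s j = s' j) :
    prefixMean G t s = prefixMean G t s' := by
  simp only [prefixMean]
  congr 2
  refine Finset.sum_congr rfl fun σ _ => ?_
  have : (∀ j : Fin T, j.1 < t → σ j = s j) ↔ ∀ j : Fin T, j.1 < t → σ j = s' j :=
    forall₂_congr fun j hj => by rw [h j hj]
  simp only [this]

theorem prefixMean_zero (s : Fin T → ℤˣ) : prefixMean G 0 s = (∑ σ, G σ) / 2 ^ T := by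
  simp [prefixMean]

theorem prefixMean_self (s : Fin T → ℤˣ) : prefixMean G T s = G s := by
  have (σ : Fin T → ℤˣ) : (∀ j : Fin T, j.1 < T → σ j = s j) ↔ σ = s :=
    ⟨fun h => funext fun j => h j j.2, fun h j _ => congrFun h j⟩
  simp only [prefixMean, this]
  simp

/-- Martingale property: the paths through a prefix split according to their sign at `t`. -/
theorem prefixMean_eq (t : Fin T) (s : Fin T → ℤˣ) :
    prefixMean G t s = (prefixMean G (t + 1) (Function.update s t 1) +
      prefixMean G (t + 1) (Function.update s t (-1))) / 2 := by
  have key (σ : Fin T → ℤˣ) (y : ℤˣ) :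
      (∀ j : Fin T, j.1 < t.1 + 1 → σ j = Function.update s t y j) ↔
        (∀ j : Fin T, j.1 < t.1 → σ j = s j) ∧ σ t = y := by
    constructor
    · refine fun h => ⟨fun j hj => ?_, by simpa using h t (Nat.lt_succ_self _)⟩
      rw [h j (hj.trans (Nat.lt_succ_self _)), Function.update_of_ne (Fin.ne_of_lt hj)]
    · rintro ⟨h, rfl⟩ j hj
      rcases eq_or_ne j t with rfl | hne
      · simp
      · rw [Function.update_of_ne hne]
        exact h j (lt_of_le_of_ne (Nat.lt_succ_iff.1 hj) (Fin.val_ne_of_ne hne))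
  have hsum : (∑ σ : Fin T → ℤˣ, if ∀ j : Fin T, j.1 < t.1 → σ j = s j then G σ else 0) =
      (∑ σ : Fin T → ℤˣ, if ∀ j : Fin T, j.1 < t.1 + 1 → σ j = Function.update s t 1 j
        then G σ else 0) +
      ∑ σ : Fin T → ℤˣ, if ∀ j : Fin T, j.1 < t.1 + 1 → σ j = Function.update s t (-1) j
        then G σ else 0 := by
    rw [← Finset.sum_add_distrib]
    refine Finset.sum_congr rfl fun σ _ => ?_
    simp only [key]
    have h1 : (1 : ℤˣ) ≠ -1 := by decide
    by_cases h : ∀ j : Fin T, j.1 < t.1 → σ j = s j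
    · rcases Int.units_eq_one_or (σ t) with h' | h' <;> simp only [h', h1, h1.symm] <;> simp
    · simp only [h, false_and, if_false, add_zero]
  simp only [prefixMean]
  rw [hsum, pow_succ]
  ring

/-- The sign `y` for round `t` that makes `prefixMean G (t + 1) - f * y` largest. -/
def bestSign (t : Fin T) (s : Fin T → ℤˣ) (f : ℝ) : ℤˣ :=
  if prefixMean G (t + 1) (Function.update s t (-1)) + f ≤
    prefixMean G (t + 1) (Function.update s t 1) - f then 1 else -1

/-- The larger of two numbers is at least their average, and the terms `± f` cancel in that average.
-/
theorem prefixMean_le_bestSign (t : Fin T) (s : Fin T → ℤˣ) (f : ℝ) :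
    prefixMean G t s + f * ((bestSign G t s f : ℤ) : ℝ) ≤
      prefixMean G (t + 1) (Function.update s t (bestSign G t s f)) := by
  rw [prefixMean_eq, bestSign]
  split_ifs with h <;> simp <;> linarith

/-- Method of conditional expectations. The sequence `s t` is what is known before round `t`, so it
need agree with `σ` only there. -/
theorem mean_add_le_of_bestSign (f : Fin T → ℝ) (σ : Fin T → ℤˣ)
    (s : Fin T → Fin T → ℤˣ) (hs : ∀ t j : Fin T, j.1 < t.1 → s t j = σ j)
    (hσ : ∀ t, σ t = bestSign G t (s t) (f t)) :
    (∑ τ, G τ) / 2 ^ T + ∑ t, f t * ((σ t : ℤ) : ℝ) ≤ G σ := by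
  have main (t : ℕ) (ht : t ≤ T) : (∑ τ, G τ) / 2 ^ T +
      ∑ j : Fin t, f (Fin.castLE ht j) * ((σ (Fin.castLE ht j) : ℤ) : ℝ) ≤
        prefixMean G t σ := by
    induction t with
    | zero => simp [prefixMean_zero]
    | succ t ih =>
      have h := prefixMean_le_bestSign G ⟨t, ht⟩ (s ⟨t, ht⟩) (f ⟨t, ht⟩)
      rw [← hσ, prefixMean_congr G (hs ⟨t, ht⟩),
        prefixMean_congr G (t := t + 1) (s' := σ) fun j hj => ?_] at h
      · rw [Fin.sum_univ_castSucc, ← add_assoc]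
        exact (add_le_add_left (ih (Nat.le_of_succ_le ht)) _).trans h
      · rcases eq_or_ne j ⟨t, ht⟩ with rfl | hne
        · simp
        · rw [Function.update_of_ne hne]
          exact hs ⟨t, ht⟩ j
            (lt_of_le_of_ne (Nat.lt_succ_iff.1 hj) fun h => hne (Fin.ext h))
  simpa [prefixMean_self] using main T le_rfl

end PrefixMean

/-! ### Walking down a tree against a given learner -/

/-- A sign as a label. -/
def signLabel (s : ℤˣ) : Label :=
  ⟨((s : ℤ) : ℝ), by rcases Int.units_eq_one_or s with rfl | rfl <;> norm_num⟩

/-- The sign of a label. -/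
def labelSign (y : Label) : ℤˣ := if 0 ≤ (y : ℝ) then 1 else -1

theorem labelSign_signLabel (s : ℤˣ) : labelSign (signLabel s) = s := by
  rcases Int.units_eq_one_or s with rfl | rfl <;> norm_num [labelSign, signLabel]

/-- The signs of the labels in a record, continued by `1`. -/
def recordSigns {X : Type u} {T : ℕ} (t : Fin T) (h : Fin t → Round X) : Fin T → ℤˣ :=
  -- The filler 1 is harmless: the tree label reads only earlier signs, and `bestSign` overwrites
  -- position `t` and ignores later ones.
  fun j => if hj : j.1 < t.1 then labelSign (h ⟨j, hj⟩).label else 1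

/-- `sup_c ∑ᵢ σᵢ c(𝐱ᵢ(σ))` as a function of the path `σ`. -/
def pathSup {X : Type u} (C : Set (Predictor X)) {T : ℕ} (x : BinTree X T) (σ : Fin T → ℤˣ) :
    ℝ :=
  ⨆ c : C, signedSum c.1 x σ

/-- The context on the tree `x` to which the record `h` leads. -/
def treeContext {X : Type u} {T : ℕ} (x : BinTree X T) (t : Fin T) (h : Fin t → Round X) : X :=
  x.label (recordSigns t h) t

/-- The expected prediction of `L` in the context given by the tree `x`. -/
def meanPrediction {X : Type u} {T : ℕ} (L : Learner.{u, w} X T) (x : BinTree X T) (t : Fin T)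
    (h : Fin t → Round X) : ℝ :=
  ∫ q : Predictor X, (q (treeContext x t h) : ℝ) ∂(L.strategy t h : Measure (Predictor X))

/-- The sign that the adversary on the tree `x` chooses against `L`. -/
def treeSign {X : Type u} {T : ℕ} (L : Learner.{u, w} X T) (C : Set (Predictor X))
    (x : BinTree X T) (t : Fin T) (h : Fin t → Round X) : ℤˣ :=
  bestSign (pathSup C x) t (recordSigns t h) (meanPrediction L x t h)

/-- The adversary that moves along the tree `x` and labels so as to keep the regret of `L` at
least the expectation of `pathSup C x`. -/
def treeAdversary {X : Type u} {T : ℕ} (L : Learner.{u, w} X T) (C : Set (Predictor X))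
    (x : BinTree X T) : Adversary X T :=
  fun t h => (treeContext x t h, signLabel (treeSign L C x t h))

theorem mul_treeSrad {X : Type u} (C : Set (Predictor X)) {T : ℕ} (x : BinTree X T) :
    T * treeSrad C x = (∑ σ, pathSup C x σ) / 2 ^ T := by
  rw [treeSrad, ← mul_div_assoc, Finset.mul_sum]
  congr 1
  refine Finset.sum_congr rfl fun σ _ => ?_
  rw [Real.mul_iSup_of_nonneg (Nat.cast_nonneg T), pathSup]
  congr 1
  ext c
  rcases Nat.eq_zero_or_pos T with rfl | hT
  · simp [signedSum]
  · have : (T : ℝ) ≠ 0 := by positivity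
    rw [← mul_assoc, mul_one_div_cancel this, one_mul, signedSum]

/-- The adversary recovers its own earlier signs from the labels, so all rounds follow one path. -/
theorem recordSigns_past {X : Type u} {T : ℕ} (L : Learner.{u, w} X T) (C : Set (Predictor X))
    (x : BinTree X T) (ω : Fin T → L.Ω) (t j : Fin T) (hj : j.1 < t.1) :
    recordSigns t (past L (treeAdversary L C x) ω t) j =
      treeSign L C x j (past L (treeAdversary L C x) ω j) := by
  rw [recordSigns, dif_pos hj]
  have h := congrArg Prod.snd (move_past L (treeAdversary L C x) ω t ⟨j, hj⟩)
  change (past L (treeAdversary L C x) ω t ⟨j, hj⟩).label = signLabel _ at h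
  rw [h, labelSign_signLabel]
  rfl

theorem mul_treeSrad_le_of_regret_le {X : Type u} {C : Set (Predictor X)} (hC : C.Nonempty)
    {T : ℕ} (L : Learner.{u, w} X T) (x : BinTree X T) (ω : Fin T → L.Ω) {R : ℝ}
    (hR : ∀ c ∈ C,
      ∑ t : Fin T,
          (c (treeAdversary L C x t (past L (treeAdversary L C x) ω t)).1 : ℝ) *
            ((treeAdversary L C x t (past L (treeAdversary L C x) ω t)).2 : ℝ) ≤
        ∑ t : Fin T,
          (∫ q : Predictor X,
            (q (treeAdversary L C x t (past L (treeAdversary L C x) ω t)).1 : ℝ) *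
              ((treeAdversary L C x t (past L (treeAdversary L C x) ω t)).2 : ℝ)
              ∂(L.strategy t (past L (treeAdversary L C x) ω t) : Measure (Predictor X))) + R) :
    T * treeSrad C x ≤ R := by
  have : Nonempty C := hC.to_subtype
  set A := treeAdversary L C x
  set σ : Fin T → ℤˣ := fun t => treeSign L C x t (past L A ω t)
  have hctx (t : Fin T) : (A t (past L A ω t)).1 = x.label σ t :=
    congrArg (x t) (funext fun j => recordSigns_past L C x ω t (Fin.castLE t.2.le j) j.2)
  have hlower := mean_add_le_of_bestSign (pathSup C x)
    (fun t => meanPrediction L x t (past L A ω t)) σ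
    (fun t => recordSigns t (past L A ω t)) (recordSigns_past L C x ω) fun _ => rfl
  have hupper : pathSup C x σ ≤
      ∑ t, meanPrediction L x t (past L A ω t) * ((σ t : ℤ) : ℝ) + R := by
    refine ciSup_le fun c => ?_
    have h := hR c.1 c.2
    simp only [integral_mul_const] at h
    refine le_of_eq_of_le (Finset.sum_congr rfl fun t _ => ?_) h
    rw [hctx, mul_comm]
    rfl
  rw [mul_treeSrad]
  linarith

theorem mul_srad_le_of_isOnlineWeakAgnosticLearner {X : Type u} [Nonempty X]
    {C : Set (Predictor X)} (hC : C.Nonempty) {T : ℕ} (L : Learner.{u, w} X T) {δ R : ℝ}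
    (hδ : δ < 1) (hL : IsOnlineWeakAgnosticLearner L C δ R) : T * srad T C ≤ R := by
  rw [srad, Real.mul_iSup_of_nonneg (Nat.cast_nonneg T)]
  refine ciSup_le fun x => ?_
  by_contra hx
  have h := hL (treeAdversary L C x)
  -- If some tree exceeded `R`, every coin sequence would fail, giving failure probability 1 > `δ`.
  have hu := Set.eq_univ_of_forall fun ω => Set.mem_ofPred.2 fun hω =>
    hx (mul_treeSrad_le_of_regret_le hC L x ω hω)
  rw [hu] at h
  have : IsProbabilityMeasure L.coinLaw := by
    unfold Learner.coinLaw
    infer_instance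
  rw [measure_univ] at h
  exact absurd h (not_le.2 (by simpa using hδ))

end OnlineWeakAgnostic

end

theorem mainTheorem12 :
    ∃ a A : ℝ, 0 < a ∧ 0 < A ∧
      ∀ (X : Type u) [Nonempty X] (C : Set (OnlineWeakAgnostic.Predictor X)), C.Nonempty →
        ∀ T : ℕ,
          (∃ L : OnlineWeakAgnostic.Learner.{u, w} X T, ∀ δ : ℝ, 0 < δ → δ < 1 →
            OnlineWeakAgnostic.IsOnlineWeakAgnosticLearner L C δ
              (A * (T * OnlineWeakAgnostic.srad T C))) ∧
          (∀ (L : OnlineWeakAgnostic.Learner.{u, w} X T) (δ : ℝ), 0 < δ → δ < 1 → ∀ R : ℝ,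
            OnlineWeakAgnostic.IsOnlineWeakAgnosticLearner L C δ R →
              a * (T * OnlineWeakAgnostic.srad T C) ≤ R) := by
  refine ⟨1, 1, one_pos, one_pos, fun X _ C hC T => ⟨⟨OnlineWeakAgnostic.potentialLearner C T,
    fun δ _ _ => ?_⟩, fun L δ _ hδ R hL => ?_⟩⟩
  · rw [one_mul]
    exact OnlineWeakAgnostic.isOnlineWeakAgnosticLearner_potentialLearner C T δ
  · rw [one_mul]
    exact OnlineWeakAgnostic.mul_srad_le_of_isOnlineWeakAgnosticLearner hC L hδ hL
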